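/- **Setting.** Let $n,\ell\ge 0$. A hash family is $h_*=(h_0,h_1,\dots,h_\ell)$ with $h_0:\{0,1\}^{3n}\to\{0,1\}^n$ and $h_i:\{0,1\}^n\to\{0,1\}^{3n}$ for $1\le i\le \ell$; the public randomness is $R=(r_1,\dots,r_\ell)\in(\{0,1\}^n)^\ell$. A subversion algorithm $\tilde H$ is a deterministic algorithm that, on input $(i,x)$, makes finitely many adaptive queries to $h_*$ and outputs a value $\tilde h_i(x)$ in the range of $h_i$. Put $\tilde g_R(x)=\bigoplus_{i=1}^{\ell}\tilde h_i(x\oplus r_i)$. The constellation of $x\in\{0,1\}^n$ consists of the points $h_i(x\oplus r_i)$, $1\le i\le\ell$; the distinguisher queries it when it queries at least one of these points. To complete the constellation of $x$ means to evaluate all $h_i(x\oplus r_i)$ and then to run $\tilde H$ to obtain all $\tilde h_i(x\oplus r_i)$, $1\le i\le \ell$, and hence $\tilde g_R(x)$; when this is done with a table, values not yet in the table are drawn uniformly and recorded. A distinguisher $\mathcal D$ is deterministic, receives $R$, and adaptively makes finitely many queries to two oracles: $\mathcal A$ (for a function $F:\{0,1\}^n\to\{0,1\}^n$) and $\mathcal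 B$ (for the $h_i$). It is in normal form: whatever the answers are, at the end of the interaction there is no $x$ such that $F(x)$ has been queried but the constellation of $x$ has not. In the abbreviated model, $\tilde H$ is fixed before $R$ is drawn uniformly. The transcript of a game consists of $R$ and the ordered list of (query, answer) pairs. * **Game 1 (construction).** $h_*$ is uniform; $\mathcal A$ answers $x$ by $\tilde h_0(\tilde g_R(x))$ and $\mathcal B$ answers with $h_*$. * **Game 2 (unsubverted $h_0$, lazily evaluated).** $h_*$ is uniform and values are revealed into tables $T_F,T_H$ as needed. A query $h_0(y)$ to $\mathcal B$ evaluates $h_0(y)$. A query $h_i(x)$ to $\mathcal B$, $i>0$, evaluates $h_i(x)$, completes the constellation of $x'=x\oplus r_i$, evaluates $h_0(\tilde g_R(x'))$, and sets $F(x')$ to this value unless it is already assigned. A query $x$ to $\mathcal A$ returns $F(x)$ if it is assigned; otherwise it completes the constellation of $x$, evaluates $h_0(\tilde g_R(x))$, assigns this value to $F(x)$ and returns it. * **Game 4 (abbreviated simulator).** $F$ is uniform, and $\mathcal A$ answers with $F$. Independently, $\mathcal B$ answers from a table of the $h_i$, initially empty, where fresh values are uniform and independent. A query $h_0(y)$ is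 answered from the table, after drawing a fresh value if there is none. On a query $h_i(x)$, $i>0$, $\mathcal B$ completes the constellation of $x'=x\oplus r_i$; if $h_0(\tilde g_R(x'))$ is then unassigned, it is set to $F(x')$; then $h_i(x)$ is returned. **Crisis events**, in Game 2 (with $\tilde h_i,\tilde g_R$ determined by the full family $h_*$): * $\mathrm{SUBV}$: $\mathcal D$ queries the constellation of some $x$ with $\tilde h_0(\tilde g_R(x))\ne h_0(\tilde g_R(x))$. * $\mathrm{PRED}$: for some $x$, $\mathcal D$ queries the constellation of $x$ for the first time, and $h_0(\tilde g_R(x))$ has already been evaluated by $\mathcal B$ in answering an earlier query. * $\mathrm{SELFREF}$: $\mathcal D$ queries the constellation of some $x$ such that $h_0$ is evaluated at $\tilde g_R(x)$ during the completion of the constellation of $x$. **Theorem.** For every subversion algorithm $\tilde H$ and every distinguisher $\mathcal D$ as above, the transcripts $\alpha_1$ of Game 1 and $\alpha_4$ of Game 4 satisfy $$\|\alpha_1-\alpha_4\|_{\mathrm{TV}}\le \Pr[\mathrm{SUBV}]+\Pr[\mathrm{PRED}]+\Pr[\mathrm{SELFREF}].$$ -/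

import Mathlib

/-- Bit strings of length `m`; the addition of `Fin m → ZMod 2` is bitwise XOR. -/
abbrev Bits (m : ℕ) : Type := Fin m → ZMod 2

namespace Crooked

/-! ### Hash families, tables and oracle algorithms -/

/-- A query to the hash family: `zero y` asks for `h₀(y)`, with `y ∈ {0,1}³ⁿ`, and `pos i x`
asks for `hᵢ(x)`, with `x ∈ {0,1}ⁿ`.  The indices `1, …, ℓ` are the elements of `Fin ℓ`. -/
inductive HQuery (n ℓ : ℕ) : Type
  | zero (y : Bits (3 * n))
  | pos (i : Fin ℓ) (x : Bits n)
  deriving DecidableEq, Fintype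

/-- The type of answers to a hash query: `h₀` has values in `{0,1}ⁿ`, and `hᵢ`, for `i > 0`, has
values in `{0,1}³ⁿ`. -/
abbrev HQuery.Ans {n ℓ : ℕ} : HQuery n ℓ → Type
  | .zero _ => Bits n
  | .pos _ _ => Bits (3 * n)

instance {n ℓ : ℕ} (q : HQuery n ℓ) : Fintype q.Ans :=
  match q with
  | .zero _ => inferInstanceAs (Fintype (Bits n))
  | .pos _ _ => inferInstanceAs (Fintype (Bits (3 * n)))

instance {n ℓ : ℕ} (q : HQuery n ℓ) : Nonempty q.Ans :=
  match q with
  | .zero _ => inferInstanceAs (Nonempty (Bits n))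
  | .pos _ _ => inferInstanceAs (Nonempty (Bits (3 * n)))

/-- A full family `h_* = (h₀, h₁, …, h_ℓ)` of functions. -/
abbrev Hash (n ℓ : ℕ) : Type := (q : HQuery n ℓ) → q.Ans

/-- A table holding the values of `h₀, …, h_ℓ` that have been assigned so far. -/
abbrev Table (n ℓ : ℕ) : Type := (q : HQuery n ℓ) → Option q.Ans

/-- The public randomness `R = (r₁, …, r_ℓ)`. -/
abbrev Coins (n ℓ : ℕ) : Type := Fin ℓ → Bits n

/-- A deterministic algorithm with oracle access to `h_*`, as a decision tree: it returns a value
or asks a (adaptively chosen) query and continues according to the answer. -/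
inductive OracleAlg (n ℓ : ℕ) (α : Type) : Type
  | ret (a : α)
  | ask (q : HQuery n ℓ) (k : q.Ans → OracleAlg n ℓ α)

namespace OracleAlg

variable {n ℓ : ℕ} {α β : Type}

/-- Run one algorithm after another. -/
def bind : OracleAlg n ℓ α → (α → OracleAlg n ℓ β) → OracleAlg n ℓ β
  | .ret a, f => f a
  | .ask q k, f => .ask q fun v => (k v).bind f

/-- The single query `q`. -/
def query (q : HQuery n ℓ) : OracleAlg n ℓ q.Ans := .ask q .ret

/-- Ask all queries of a list, in order. -/
def queryAll : List (HQuery n ℓ) → OracleAlg n ℓ Unit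
  | [] => .ret ()
  | q :: l => .ask q fun _ => queryAll l

/-- Run a list of algorithms in order and return the sum of their values. -/
def sumAll [AddCommMonoid α] : List (OracleAlg n ℓ α) → OracleAlg n ℓ α
  | [] => .ret 0
  | t :: l => t.bind fun a => (sumAll l).bind fun b => .ret (a + b)

/-- The value computed with the fully determined oracle `h`. -/
def run (h : Hash n ℓ) : OracleAlg n ℓ α → α
  | .ret a => a
  | .ask q k => (k (h q)).run h

/-- The outcome of a computation by lazy evaluation: the returned value, the updated table, and
the list of all points of the family that were evaluated in the course of the computation. -/
structure Outcome (n ℓ : ℕ) (α : Type) where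
  value : α
  table : Table n ℓ
  log : List (HQuery n ℓ)

/-- Run an algorithm by lazy evaluation, starting from the table `T`: a value that is in the table
is looked up, any other value is drawn from `fresh` and recorded in the table. -/
def lazyRun (fresh : Hash n ℓ) : OracleAlg n ℓ α → Table n ℓ → Outcome n ℓ α
  | .ret a, T => ⟨a, T, []⟩
  | .ask q k, T =>
      let v : q.Ans := (T q).getD (fresh q)
      let o := (k v).lazyRun fresh (Function.update T q (some v))
      ⟨o.value, o.table, q :: o.log⟩

end OracleAlg

/-! ### The subversion algorithm and the construction -/

/-- A subversion algorithm: a deterministic oracle algorithm that, on input `(i, x)`, computes the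
subverted value of `hᵢ(x)`. -/
abbrev Subversion (n ℓ : ℕ) : Type := (q : HQuery n ℓ) → OracleAlg n ℓ q.Ans

section Construction

variable {n ℓ : ℕ}

/-- The subverted family determined by `h_*`. -/
def Subversion.subvert (S : Subversion n ℓ) (h : Hash n ℓ) : Hash n ℓ := fun q => (S q).run h

/-- The internal function `g̃_R(x) = ⨁ᵢ h̃ᵢ(x ⊕ rᵢ)`. -/
def gTilde (S : Subversion n ℓ) (h : Hash n ℓ) (R : Coins n ℓ) (x : Bits n) : Bits (3 * n) :=
  ∑ i : Fin ℓ, (S.subvert h (.pos i (x + R i)) : Bits (3 * n))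

/-- The construction `C(x) = h̃₀(g̃_R(x))`. -/
def construction (S : Subversion n ℓ) (h : Hash n ℓ) (R : Coins n ℓ) (x : Bits n) : Bits n :=
  S.subvert h (.zero (gTilde S h R x))

/-- The completion of the constellation of `x`: evaluate all the `hᵢ(x ⊕ rᵢ)`, then run the
subversion algorithm for each `h̃ᵢ(x ⊕ rᵢ)`, and return `g̃_R(x)`, the sum of the results. -/
def complete (S : Subversion n ℓ) (R : Coins n ℓ) (x : Bits n) : OracleAlg n ℓ (Bits (3 * n)) :=
  (OracleAlg.queryAll ((List.finRange ℓ).map fun i => HQuery.pos i (x + R i))).bind fun _ =>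
    OracleAlg.sumAll ((List.finRange ℓ).map fun i =>
      (S (.pos i (x + R i)) : OracleAlg n ℓ (Bits (3 * n))))

end Construction

/-! ### Distinguishers, interactions and transcripts -/

/-- A query of the distinguisher: `toF x` goes to the oracle `𝒜` (for `F`), and `toH q` goes to the
oracle `ℬ` (for the `hᵢ`). -/
inductive Query (n ℓ : ℕ) : Type
  | toF (x : Bits n)
  | toH (q : HQuery n ℓ)

/-- The type of answers to a query of the distinguisher. -/
abbrev Query.Ans {n ℓ : ℕ} : Query n ℓ → Type
  | .toF _ => Bits n
  | .toH q => q.Ans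

/-- The query belongs to the constellation of `x`: it asks for some `hᵢ(x ⊕ rᵢ)` with `i > 0`. -/
def Query.InConstellation {n ℓ : ℕ} (R : Coins n ℓ) (x : Bits n) (q : Query n ℓ) : Prop :=
  ∃ i : Fin ℓ, q = .toH (.pos i (x + R i))

/-- The sequence of (query, answer) pairs of an interaction. -/
abbrev Pairs (n ℓ : ℕ) : Type := List (Σ q : Query n ℓ, q.Ans)

/-- A transcript: the randomness `R` and the sequence of (query, answer) pairs. -/
abbrev Transcript (n ℓ : ℕ) : Type := Coins n ℓ × Pairs n ℓ

/-- A deterministic adaptive query strategy, as a decision tree. -/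
inductive Strategy (n ℓ : ℕ) : Type
  | halt
  | ask (q : Query n ℓ) (k : q.Ans → Strategy n ℓ)

/-- One step of an interaction: the internal state of the oracles before it, the query of the
distinguisher, and the answer. -/
structure Step (n ℓ : ℕ) (σ : Type) where
  before : σ
  query : Query n ℓ
  answer : query.Ans

namespace Strategy

variable {n ℓ : ℕ} {σ : Type}

/-- The steps of the interaction of a strategy with stateful oracles. -/
def steps (respond : σ → (q : Query n ℓ) → q.Ans × σ) : Strategy n ℓ → σ → List (Step n ℓ σ)
  | .halt, _ => []
  | .ask q k, s => ⟨s, q, (respond s q).1⟩ :: (k (respond s q).1).steps respond (respond s q).2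

/-- The (query, answer) pairs of the interaction of a strategy with stateful oracles. -/
def pairs (respond : σ → (q : Query n ℓ) → q.Ans × σ) (D : Strategy n ℓ) (s : σ) : Pairs n ℓ :=
  (D.steps respond s).map fun t => ⟨t.query, t.answer⟩

/-- `D.Completed t`: `t` is the sequence of pairs of a completed interaction of `D`, for some
answers to its queries. -/
def Completed : Strategy n ℓ → Pairs n ℓ → Prop
  | .halt, t => t = []
  | .ask q k, t => ∃ (a : q.Ans) (t' : Pairs n ℓ), t = ⟨q, a⟩ :: t' ∧ (k a).Completed t'

end Strategy

/-- A deterministic distinguisher, which is given `R`. -/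
abbrev Distinguisher (n ℓ : ℕ) : Type := Coins n ℓ → Strategy n ℓ

/-- The normal form: at the end of an interaction there is no `x` such that `F(x)` has been queried
but the constellation of `x` has not. -/
def Distinguisher.NormalForm {n ℓ : ℕ} (D : Distinguisher n ℓ) : Prop :=
  ∀ (R : Coins n ℓ) (t : Pairs n ℓ), (D R).Completed t →
    ∀ x : Bits n, (∃ p ∈ t, p.1 = .toF x) → ∃ p ∈ t, p.1.InConstellation R x

/-! ### The games -/

section Games

variable {n ℓ : ℕ}

/-- Game 1: `𝒜` answers with the construction, `ℬ` with the hash family (there is no state). -/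
def respond1 (S : Subversion n ℓ) (R : Coins n ℓ) (h : Hash n ℓ) :
    Unit → (q : Query n ℓ) → q.Ans × Unit
  | _, .toF x => (construction S h R x, ())
  | _, .toH q => (h q, ())

/-- The state of Game 2: the tables `T_F` and `T_H`, and the list of all points of the hash family
that have been evaluated by the simulator `ℬ`, that is, in answering queries to `ℬ`. -/
structure State2 (n ℓ : ℕ) where
  TF : Bits n → Option (Bits n)
  TH : Table n ℓ
  sim : List (HQuery n ℓ)

/-- The initial state of Game 2: nothing has been assigned. -/
def State2.init (n ℓ : ℕ) : State2 n ℓ := ⟨fun _ => none, fun _ => none, []⟩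

/-- Game 2 (the construction with unsubverted `h₀`, by lazy evaluation).  New values of the hash
family are drawn from `h`, so that `h` is also the family obtained when the empty cells of `T_H`
are filled in after the interaction. -/
def respond2 (S : Subversion n ℓ) (R : Coins n ℓ) (h : Hash n ℓ) :
    State2 n ℓ → (q : Query n ℓ) → q.Ans × State2 n ℓ
  | s, .toH (.zero y) =>
      let a := (OracleAlg.query (.zero y)).lazyRun h s.TH
      (a.value, ⟨s.TF, a.table, s.sim ++ a.log⟩)
  | s, .toH (.pos i x) =>
      let a := (OracleAlg.query (.pos i x)).lazyRun h s.TH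
      let c := (complete S R (x + R i)).lazyRun h a.table
      let d := (OracleAlg.query (.zero c.value)).lazyRun h c.table
      (a.value,
        ⟨Function.update s.TF (x + R i) (some ((s.TF (x + R i)).getD d.value)), d.table,
          s.sim ++ a.log ++ c.log ++ d.log⟩)
  | s, .toF x =>
      match s.TF x with
      | some v => (v, s)
      | none =>
          let c := (complete S R x).lazyRun h s.TH
          let d := (OracleAlg.query (.zero c.value)).lazyRun h c.table
          (d.value, ⟨Function.update s.TF x (some d.value), d.table, s.sim⟩)

/-- Game 4 (the abbreviated simulator).  The state is the table of the simulator.  Queries to `𝒜`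
are answered by `F` and do not involve the simulator.  A query to `hᵢ(x)` with `i > 0` makes the
simulator complete the constellation of `x' = x ⊕ rᵢ` and, if `h₀(g̃_R(x'))` has not been assigned
so far, program it to `F(x')`.  All other new values are drawn from `h`. -/
def respond4 (S : Subversion n ℓ) (R : Coins n ℓ) (F : Bits n → Bits n) (h : Hash n ℓ) :
    Table n ℓ → (q : Query n ℓ) → q.Ans × Table n ℓ
  | T, .toF x => (F x, T)
  | T, .toH (.zero y) =>
      let a := (OracleAlg.query (.zero y)).lazyRun h T
      (a.value, a.table)
  | T, .toH (.pos i x) =>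
      let c := (complete S R (x + R i)).lazyRun h T
      let v : Bits n := (c.table (.zero c.value)).getD (F (x + R i))
      let a := (OracleAlg.query (.pos i x)).lazyRun h
        (Function.update c.table (.zero c.value) (some v))
      (a.value, a.table)

/-- The transcript of Game 1, for given random choices. -/
def transcript1 (S : Subversion n ℓ) (D : Distinguisher n ℓ)
    (ω : Coins n ℓ × Hash n ℓ) : Transcript n ℓ :=
  (ω.1, (D ω.1).pairs (respond1 S ω.1 ω.2) ())

/-- The steps of Game 2, for given random choices. -/
def steps2 (S : Subversion n ℓ) (D : Distinguisher n ℓ)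
    (ω : Coins n ℓ × Hash n ℓ) : List (Step n ℓ (State2 n ℓ)) :=
  (D ω.1).steps (respond2 S ω.1 ω.2) (State2.init n ℓ)

/-- The transcript of Game 4, for given random choices: `R`, the function `F`, and the hash family
from which the simulator draws fresh values. -/
def transcript4 (S : Subversion n ℓ) (D : Distinguisher n ℓ)
    (ω : Coins n ℓ × (Bits n → Bits n) × Hash n ℓ) : Transcript n ℓ :=
  (ω.1, (D ω.1).pairs (respond4 S ω.1 ω.2.1 ω.2.2) fun _ => none)

/-! ### The crisis events of Game 2 -/

/-- The distinguisher queries a constellation `x` such that `g̃_R(x)` falls into the subverted area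
of `h₀`. -/
def SUBV (S : Subversion n ℓ) (D : Distinguisher n ℓ) : Set (Coins n ℓ × Hash n ℓ) :=
  {ω | ∃ t ∈ steps2 S D ω, ∃ x : Bits n, t.query.InConstellation ω.1 x ∧
    S.subvert ω.2 (.zero (gTilde S ω.2 ω.1 x)) ≠ ω.2 (.zero (gTilde S ω.2 ω.1 x))}

/-- For some `x`, the distinguisher queries the constellation of `x` for the first time, and
`h₀(g̃_R(x))` has already been evaluated by the simulator `ℬ`.

An assignment of `h₀(g̃_R(x))` that was made by `𝒜` alone does not count; with such assignments
counted, the event would occur whenever `F(x)` is queried before the constellation of `x`.  All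
points in `sim` are assigned in `T_H`, so this event lies in the one defined through `T_H`. -/
def PRED (S : Subversion n ℓ) (D : Distinguisher n ℓ) : Set (Coins n ℓ × Hash n ℓ) :=
  {ω | ∃ pre t post, steps2 S D ω = pre ++ t :: post ∧
    ∃ x : Bits n, t.query.InConstellation ω.1 x ∧
      (∀ u ∈ pre, ¬ u.query.InConstellation ω.1 x) ∧
      HQuery.zero (gTilde S ω.2 ω.1 x) ∈ t.before.sim}

/-- The distinguisher queries a constellation `x` such that `h₀` at `g̃_R(x)` is evaluated during
the completion of the constellation of `x`. -/
def SELFREF (S : Subversion n ℓ) (D : Distinguisher n ℓ) : Set (Coins n ℓ × Hash n ℓ) :=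
  {ω | ∃ t ∈ steps2 S D ω, ∃ x : Bits n, t.query.InConstellation ω.1 x ∧
    HQuery.zero (gTilde S ω.2 ω.1 x) ∈ ((complete S ω.1 x).lazyRun ω.2 t.before.TH).log}

end Games

/-! ### Probabilities -/

noncomputable section

variable {n ℓ : ℕ}

/-- The total variation distance of two discrete probability distributions. -/
def tvDist {α : Type} (p q : PMF α) : ℝ := (1 / 2) * ∑' a, |(p a).toReal - (q a).toReal|

/-- The probability of an event under the uniform choice of `R` and `h_*`. -/
def prob (E : Set (Coins n ℓ × Hash n ℓ)) : ℝ :=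
  ((PMF.uniformOfFintype (Coins n ℓ × Hash n ℓ)).toOuterMeasure E).toReal

/-- The distribution `α₁` of the transcript of Game 1. -/
def alpha1 (S : Subversion n ℓ) (D : Distinguisher n ℓ) : PMF (Transcript n ℓ) :=
  (PMF.uniformOfFintype (Coins n ℓ × Hash n ℓ)).map (transcript1 S D)

/-- The distribution `α₄` of the transcript of Game 4. -/
def alpha4 (S : Subversion n ℓ) (D : Distinguisher n ℓ) : PMF (Transcript n ℓ) :=
  (PMF.uniformOfFintype (Coins n ℓ × (Bits n → Bits n) × Hash n ℓ)).map (transcript4 S D)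

end

end Crooked

namespace Crooked

variable {n ℓ : ℕ}

/-! The proof is a coupling carried out by counting. For fixed `R` and `h`, lazy evaluation in Game
2 only reveals values of `h`, so its answers are those of a fixed function, `ideal`. By the normal
form, every `F(x)` that is asked has its constellation queried, so outside SUBV Game 1 gives these
same answers (`transcript1_of_notMem_SUBV`).

To pass to Game 4, take an independent `F` and exchange, for every `x` whose constellation is
queried, the value `F(x)` with `h₀(g̃_R(x))`. Without PRED, distinct queried constellations have
distinct `g̃_R(x)` (`CrisisFree.gTilde_injOn`), so the exchange is well defined. Without PRED and
SELFREF, the simulator never draws the exchanged value of `h₀(g̃_R(x))` as a fresh value: when it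
first needs that point, it programs it to the new `F(x)`, which is the old `h₀(g̃_R(x))`. Game 4 on
the exchanged data thus reproduces the Game 2 answers (`CrisisFree.game4_programmed`).

The exchange is injective on crisis-free data, because the final simulator table reveals what was
exchanged (`program_injective`). Hence each transcript is at most as likely in Game 1 without crisis
as in Game 4 (`card_crisisFree_le`). As both laws have total mass one, this one-sided bound controls
the total variation distance by the probability of a crisis. -/

theorem Bits.add_add_self {m : ℕ} (x r : Bits m) : x + r + r = x := by
  ext j
  simp [add_assoc, CharTwo.add_self_eq_zero]

/-! ### Lazy evaluation against a full family -/

namespace OracleAlg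

variable {α β : Type}

/-- The points at which a computation evaluates the fully determined oracle `h`. -/
def points (h : Hash n ℓ) : OracleAlg n ℓ α → List (HQuery n ℓ)
  | .ret _ => []
  | .ask q k => q :: (k (h q)).points h

theorem run_bind (h : Hash n ℓ) (t : OracleAlg n ℓ α) (f : α → OracleAlg n ℓ β) :
    (t.bind f).run h = (f (t.run h)).run h := by
  induction t with
  | ret a => rfl
  | ask q k ih => exact ih (h q)

theorem points_bind (h : Hash n ℓ) (t : OracleAlg n ℓ α) (f : α → OracleAlg n ℓ β) :
    (t.bind f).points h = t.points h ++ (f (t.run h)).points h := by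
  induction t with
  | ret a => rfl
  | ask q k ih => exact congrArg (q :: ·) (ih (h q))

theorem points_queryAll (h : Hash n ℓ) (l : List (HQuery n ℓ)) : (queryAll l).points h = l := by
  induction l with
  | nil => rfl
  | cons q l ih => exact congrArg (q :: ·) ih

theorem run_sumAll [AddCommMonoid α] (h : Hash n ℓ) (l : List (OracleAlg n ℓ α)) :
    (sumAll l).run h = (l.map (run h)).sum := by
  induction l with
  | nil => rfl
  | cons t l ih => simp [sumAll, run_bind, run, ih]

end OracleAlg

/-- The table that holds the values of `h` at the points of a list. -/
def Table.restrict (h : Hash n ℓ) (l : List (HQuery n ℓ)) : Table n ℓ :=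
  fun q => if q ∈ l then some (h q) else none

theorem Table.restrict_congr (h : Hash n ℓ) {l l' : List (HQuery n ℓ)}
    (hl : ∀ q, q ∈ l ↔ q ∈ l') : Table.restrict h l = Table.restrict h l' := by
  funext q
  simp only [Table.restrict, hl]

theorem Table.restrict_of_mem (h : Hash n ℓ) {l : List (HQuery n ℓ)} {q : HQuery n ℓ}
    (hq : q ∈ l) : Table.restrict h l q = some (h q) := if_pos hq

theorem Table.restrict_of_notMem (h : Hash n ℓ) {l : List (HQuery n ℓ)} {q : HQuery n ℓ}
    (hq : q ∉ l) : Table.restrict h l q = none := if_neg hq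

theorem Table.update_restrict (h : Hash n ℓ) (l : List (HQuery n ℓ)) (q : HQuery n ℓ) :
    Function.update (Table.restrict h l) q (some (h q)) = Table.restrict h (l ++ [q]) := by
  funext q'
  by_cases e : q' = q
  · subst e
    simp [Table.restrict]
  · simp [Table.restrict, e]

/-- Lazy evaluation on a table of values of `h` agrees with evaluation on `h`, provided that the
fresh values it draws are values of `h`. -/
theorem OracleAlg.lazyRun_restrict {α : Type} (h fresh : Hash n ℓ) (t : OracleAlg n ℓ α)
    (l : List (HQuery n ℓ))
    (hf : ∀ q ∈ t.points h, (Table.restrict h l q).getD (fresh q) = h q) :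
    t.lazyRun fresh (Table.restrict h l) =
      ⟨t.run h, Table.restrict h (l ++ t.points h), t.points h⟩ := by
  induction t generalizing l with
  | ret a => simp [lazyRun, run, points]
  | ask q k ih =>
    have hq : (Table.restrict h l q).getD (fresh q) = h q := hf q (by simp [points])
    have := ih (h q) (l ++ [q]) (by
      intro q' hq'
      by_cases hm : q' ∈ l ++ [q]
      · rw [Table.restrict_of_mem h hm]; rfl
      · rw [Table.restrict_of_notMem h hm]
        have := hf q' (by simp [points, hq'])
        rwa [Table.restrict_of_notMem h (fun hc => hm (by simp [hc]))] at this)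
    simp only [lazyRun, hq, Table.update_restrict, this, run, points, List.append_assoc,
      List.singleton_append]

theorem OracleAlg.lazyRun_restrict_self {α : Type} (h : Hash n ℓ) (t : OracleAlg n ℓ α)
    (l : List (HQuery n ℓ)) :
    t.lazyRun h (Table.restrict h l) =
      ⟨t.run h, Table.restrict h (l ++ t.points h), t.points h⟩ := by
  refine t.lazyRun_restrict h h l fun q _ => ?_
  by_cases hm : q ∈ l
  · rw [Table.restrict_of_mem h hm]; rfl
  · rw [Table.restrict_of_notMem h hm]; rfl

theorem run_complete (S : Subversion n ℓ) (R : Coins n ℓ) (h : Hash n ℓ) (x : Bits n) :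
    (complete S R x).run h = gTilde S h R x := by
  simp only [complete, OracleAlg.run_bind, OracleAlg.run_sumAll, List.map_map, gTilde]
  rw [← Fin.sum_univ_def]
  rfl

theorem pos_mem_points_complete (S : Subversion n ℓ) (R : Coins n ℓ) (h : Hash n ℓ) (x : Bits n)
    (i : Fin ℓ) : HQuery.pos i (x + R i) ∈ (complete S R x).points h := by
  simp [complete, OracleAlg.points_bind, OracleAlg.points_queryAll]

/-! ### Interactions with stateless oracles -/

namespace Strategy

/-- The interaction of a strategy with oracles that answer according to a fixed function. -/
def play (f : (q : Query n ℓ) → q.Ans) : Strategy n ℓ → Pairs n ℓ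
  | .halt => []
  | .ask q k => ⟨q, f q⟩ :: (k (f q)).play f

/-- The state of the oracles at the end of an interaction. -/
def finalState {σ : Type} (respond : σ → (q : Query n ℓ) → q.Ans × σ) : Strategy n ℓ → σ → σ
  | .halt, s => s
  | .ask q k, s => (k (respond s q).1).finalState respond (respond s q).2

/-- The queries asked in the interaction with a fixed function. -/
def queries (f : (q : Query n ℓ) → q.Ans) (D : Strategy n ℓ) : List (Query n ℓ) :=
  (D.play f).map Sigma.fst

theorem queries_ask (f : (q : Query n ℓ) → q.Ans) (q : Query n ℓ) (k : q.Ans → Strategy n ℓ) :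
    (Strategy.ask q k).queries f = q :: (k (f q)).queries f := rfl

theorem completed_play (f : (q : Query n ℓ) → q.Ans) (D : Strategy n ℓ) :
    D.Completed (D.play f) := by
  induction D with
  | halt => rfl
  | ask q k ih => exact ⟨f q, _, rfl, ih (f q)⟩

theorem play_congr {f g : (q : Query n ℓ) → q.Ans} (D : Strategy n ℓ)
    (hfg : ∀ q ∈ D.queries f, g q = f q) : D.play g = D.play f := by
  induction D with
  | halt => rfl
  | ask q k ih =>
    rw [queries_ask] at hfg
    have hq : g q = f q := hfg q (by simp)
    simp only [play, hq]
    rw [ih (f q) fun q' hq' => hfg q' (List.mem_cons_of_mem _ hq')]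

end Strategy

/-! ### Game 2 as evaluation of a fixed family -/

section Ideal

variable (S : Subversion n ℓ) (R : Coins n ℓ) (h : Hash n ℓ)

/-- The answers of Game 2, as a function of the family `h`: `F(x) = h₀(g̃_R(x))`. -/
def ideal : (q : Query n ℓ) → q.Ans
  | .toF x => h (.zero (gTilde S h R x))
  | .toH q => h q

/-- The points evaluated by the simulator of Game 2 in answering a query. -/
def simPoints : Query n ℓ → List (HQuery n ℓ)
  | .toF _ => []
  | .toH (.zero y) => [.zero y]
  | .toH (.pos i x) =>
      .pos i x :: ((complete S R (x + R i)).points h ++ [.zero (gTilde S h R (x + R i))])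

theorem pairs_respond1 (D : Strategy n ℓ) :
    D.pairs (respond1 S R h) () = D.play fun q => (respond1 S R h () q).1 := by
  induction D with
  | halt => rfl
  | ask q k ih => exact congrArg (_ :: ·) (ih _)

/-- The invariant of Game 2: the tables hold values determined by `h`. -/
structure Consistent (s : State2 n ℓ) : Prop where
  eq_of_TF : ∀ x v, s.TF x = some v → v = h (.zero (gTilde S h R x))
  exists_restrict : ∃ l, s.TH = Table.restrict h l

theorem consistent_init : Consistent S R h (State2.init n ℓ) :=
  ⟨fun _ _ hv => by simp [State2.init] at hv, [], by funext q; simp [State2.init, Table.restrict]⟩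

/-- Lazy evaluation against `h` from a table of values of `h` stays inside `h`, so it does not
matter which oracle assigned `F(x)` or when. Evaluations made by `𝒜` enlarge the table but not
`sim`, which is why `simPoints` is empty on `toF`. -/
theorem respond2_spec (s : State2 n ℓ) (hs : Consistent S R h s) (q : Query n ℓ) :
    (respond2 S R h s q).1 = ideal S R h q ∧ Consistent S R h (respond2 S R h s q).2 ∧
      (respond2 S R h s q).2.sim = s.sim ++ simPoints S R h q := by
  obtain ⟨TF, TH, sim⟩ := s
  obtain ⟨hF, l, hl⟩ := hs
  dsimp only at hF hl
  subst hl
  match q with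
  | .toF x =>
    cases hx : TF x with
    | some v =>
      simp only [respond2, hx]
      exact ⟨hF x v hx, ⟨hF, l, rfl⟩, by simp [simPoints]⟩
    | none =>
      simp only [respond2, hx]
      generalize hc : (complete S R x).lazyRun h (Table.restrict h l) = c
      rw [OracleAlg.lazyRun_restrict_self, run_complete] at hc
      subst hc
      simp only [OracleAlg.lazyRun_restrict_self]
      refine ⟨rfl, ⟨fun x' v hv => ?_, _, rfl⟩, by simp [simPoints]⟩
      by_cases e : x' = x
      · subst e
        simp only [Function.update_self, Option.some.injEq] at hv
        exact hv.symm
      · exact hF x' v (by simpa [Function.update_of_ne e] using hv)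
  | .toH (.zero y) =>
    simp only [respond2, OracleAlg.lazyRun_restrict_self]
    exact ⟨rfl, ⟨hF, _, rfl⟩, rfl⟩
  | .toH (.pos i x) =>
    simp only [respond2]
    generalize ha : (OracleAlg.query (.pos i x)).lazyRun h (Table.restrict h l) = a
    rw [OracleAlg.lazyRun_restrict_self] at ha
    subst ha
    dsimp only
    generalize hc : (complete S R (x + R i)).lazyRun h _ = c
    rw [OracleAlg.lazyRun_restrict_self, run_complete] at hc
    subst hc
    simp only [OracleAlg.lazyRun_restrict_self]
    refine ⟨rfl, ⟨fun x' v hv => ?_, _, rfl⟩,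
      by simp [simPoints, OracleAlg.query, OracleAlg.points]⟩
    by_cases e : x' = x + R i
    · subst e
      simp only [Function.update_self, Option.some.injEq] at hv
      -- An earlier assignment of `F(x')` is kept, but by consistency it equals the value just
      -- computed.
      cases hx : TF (x + R i) with
      | some w => rw [hx] at hv; exact hv ▸ hF _ w hx
      | none => rw [hx] at hv; exact hv.symm
    · exact hF x' v (by simpa [Function.update_of_ne e] using hv)

theorem queries_steps_respond2 (D : Strategy n ℓ) (s : State2 n ℓ) (hs : Consistent S R h s) :
    (D.steps (respond2 S R h) s).map Step.query = D.queries (ideal S R h) := by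
  induction D generalizing s with
  | halt => rfl
  | ask q k ih =>
    obtain ⟨h1, h2, -⟩ := respond2_spec S R h s hs q
    rw [Strategy.queries_ask, ← ih _ _ h2]
    simp only [Strategy.steps, List.map_cons, h1]

/-- This turns PRED and SELFREF, which refer to the internal state of Game 2, into conditions on the
bare list of queries. -/
theorem before_steps_respond2 (D : Strategy n ℓ) (s : State2 n ℓ) (hs : Consistent S R h s)
    {pre post : List (Step n ℓ (State2 n ℓ))} {t : Step n ℓ (State2 n ℓ)}
    (ht : D.steps (respond2 S R h) s = pre ++ t :: post) :
    Consistent S R h t.before ∧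
      t.before.sim = s.sim ++ (pre.map Step.query).flatMap (simPoints S R h) := by
  induction D generalizing s pre with
  | halt => simp [Strategy.steps] at ht
  | ask q k ih =>
    obtain ⟨-, h2, h3⟩ := respond2_spec S R h s hs q
    cases pre with
    | nil =>
      simp only [Strategy.steps, List.nil_append, List.cons.injEq] at ht
      rw [← ht.1]
      exact ⟨hs, by simp⟩
    | cons u pre =>
      simp only [Strategy.steps, List.cons_append, List.cons.injEq] at ht
      obtain ⟨h4, h5⟩ := ih _ _ h2 ht.2
      refine ⟨h4, ?_⟩
      rw [h5, h3, ← ht.1]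
      simp

/-! ### Crisis-free interactions -/

/-- The list of queries meets none of the events `PRED` and `SELFREF`. -/
structure CrisisFree (Q : List (Query n ℓ)) : Prop where
  unpredicted : ∀ pre q post, Q = pre ++ q :: post → ∀ x, q.InConstellation R x →
    (∀ u ∈ pre, ¬ u.InConstellation R x) →
    HQuery.zero (gTilde S h R x) ∉ pre.flatMap (simPoints S R h)
  not_selfref : ∀ q ∈ Q, ∀ x, q.InConstellation R x →
    HQuery.zero (gTilde S h R x) ∉ (complete S R x).points h

/-- The constellation of `x` is queried. -/
def Touched (Q : List (Query n ℓ)) (x : Bits n) : Prop := ∃ q ∈ Q, q.InConstellation R x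

theorem crisisFree_of_notMem (D : Distinguisher n ℓ) (hP : (R, h) ∉ PRED S D)
    (hS : (R, h) ∉ SELFREF S D) : CrisisFree S R h ((D R).queries (ideal S R h)) := by
  have hc := consistent_init S R h
  have hQ := queries_steps_respond2 S R h (D R) _ hc
  constructor
  · intro pre q post e x hx hpre hm
    rw [← hQ, List.map_eq_append_iff] at e
    obtain ⟨pre, r, e, rfl, hr⟩ := e
    rw [List.map_eq_cons_iff] at hr
    obtain ⟨t, post, rfl, rfl, rfl⟩ := hr
    refine hP ⟨pre, t, post, e, x, hx, fun u hu => hpre _ (List.mem_map_of_mem hu), ?_⟩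
    rw [(before_steps_respond2 S R h (D R) _ hc e).2]
    exact List.mem_append_right _ hm
  · intro q hq x hx hm
    rw [← hQ, List.mem_map] at hq
    obtain ⟨t, ht, rfl⟩ := hq
    refine hS ⟨t, ht, x, hx, ?_⟩
    obtain ⟨pre, post, e⟩ := List.append_of_mem ht
    obtain ⟨l, hl⟩ := (before_steps_respond2 S R h (D R) _ hc e).1.exists_restrict
    rw [hl, OracleAlg.lazyRun_restrict_self]
    exact hm

end Ideal

theorem _root_.List.exists_first {α : Type*} {P : α → Prop} {l : List α} (hl : ∃ a ∈ l, P a) :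
    ∃ pre a post, l = pre ++ a :: post ∧ P a ∧ ∀ u ∈ pre, ¬ P u := by
  induction l with
  | nil => simp at hl
  | cons b l ih =>
    by_cases hb : P b
    · exact ⟨[], b, l, rfl, hb, by simp⟩
    · obtain ⟨pre, a, post, rfl, ha, hp⟩ := ih (by simpa [hb] using hl)
      exact ⟨b :: pre, a, post, rfl, ha, by simpa [hb] using hp⟩

/-! ### Game 4 along a crisis-free interaction -/

section CrisisFree

variable {S : Subversion n ℓ} {R : Coins n ℓ} {h : Hash n ℓ}

theorem inConstellation_pos {i : Fin ℓ} {x y : Bits n} :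
    (Query.toH (.pos i x)).InConstellation R y ↔ y = x + R i := by
  constructor
  · rintro ⟨j, hj⟩
    simp only [Query.toH.injEq, HQuery.pos.injEq] at hj
    obtain ⟨rfl, rfl⟩ := hj
    rw [Bits.add_add_self]
  · rintro rfl
    exact ⟨i, by rw [Bits.add_add_self]⟩

theorem not_inConstellation_zero {y : Bits (3 * n)} {x : Bits n} :
    ¬ (Query.toH (.zero y) : Query n ℓ).InConstellation R x := by
  rintro ⟨j, hj⟩
  simp at hj

theorem Query.InConstellation.zero_mem_simPoints {x : Bits n} {q : Query n ℓ}
    (hq : q.InConstellation R x) : HQuery.zero (gTilde S h R x) ∈ simPoints S R h q := by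
  obtain ⟨i, rfl⟩ := hq
  simp [simPoints, Bits.add_add_self]

theorem Query.InConstellation.unique {x y : Bits n} {q : Query n ℓ}
    (hx : q.InConstellation R x) (hy : q.InConstellation R y) : x = y := by
  obtain ⟨i, rfl⟩ := hx
  rw [inConstellation_pos, Bits.add_add_self] at hy
  exact hy.symm

/-- Otherwise the first query to the constellation of `x` would lie in `post` and find its point
already evaluated, which is PRED. -/
theorem CrisisFree.exists_of_mem {pre post : List (Query n ℓ)}
    (hQ : CrisisFree S R h (pre ++ post)) {x : Bits n} (hx : Touched R (pre ++ post) x)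
    (hm : HQuery.zero (gTilde S h R x) ∈ pre.flatMap (simPoints S R h)) :
    ∃ u ∈ pre, u.InConstellation R x := by
  by_contra! hc
  obtain ⟨u, hu, hux⟩ := hx
  have : ∃ u ∈ post, u.InConstellation R x := by
    rcases List.mem_append.1 hu with hu | hu
    · exact absurd hux (hc u hu)
    · exact ⟨u, hu, hux⟩
  obtain ⟨mid, q, rest, rfl, hq, hmid⟩ := List.exists_first this
  refine hQ.unpredicted (pre ++ mid) q rest (by simp) x hq ?_ ?_
  · intro v hv
    rcases List.mem_append.1 hv with hv | hv
    · exact hc v hv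
    · exact hmid v hv
  · rw [List.flatMap_append]
    exact List.mem_append_left _ hm

/-- The first query `q` to the constellation of `x` evaluates the common point, so the constellation
of `y` has been queried by then. If this happened strictly before `q`, the same argument with the
roles exchanged puts a query to the constellation of `x` before `q`, a contradiction. If it happened
at `q`, then `x = y`, since a query lies in at most one constellation. -/
theorem CrisisFree.gTilde_injOn {Q : List (Query n ℓ)} (hQ : CrisisFree S R h Q) {x y : Bits n}
    (hx : Touched R Q x) (hy : Touched R Q y) (e : gTilde S h R x = gTilde S h R y) : x = y := by
  obtain ⟨pre, q, post, rfl, hq, hpre⟩ := List.exists_first hx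
  have key : ∃ u ∈ pre ++ [q], u.InConstellation R y := by
    have hQ' : CrisisFree S R h ((pre ++ [q]) ++ post) := by simpa using hQ
    refine hQ'.exists_of_mem (by simpa using hy) ?_
    rw [← e, List.flatMap_append]
    exact List.mem_append_right _ (by simpa using hq.zero_mem_simPoints)
  obtain ⟨u, hu, huy⟩ := key
  rcases List.mem_append.1 hu with hu | hu
  · obtain ⟨v, hv, hvx⟩ := hQ.exists_of_mem hx (by
      rw [e]
      exact List.mem_flatMap.2 ⟨u, hu, huy.zero_mem_simPoints⟩)
    exact absurd hvx (hpre v hv)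
  · rw [List.mem_singleton] at hu
    subst hu
    exact hq.unique huy

/-- One step of Game 4 on a crisis-free interaction, when `F` is compatible with `h` and the fresh
values differ from those of `h` only at programmed points. -/
theorem CrisisFree.respond4_eq {pre post : List (Query n ℓ)} {q : Query n ℓ}
    (hQ : CrisisFree S R h (pre ++ q :: post)) {F : Bits n → Bits n} {fresh : Hash n ℓ}
    (hF : ∀ x, Touched R (pre ++ q :: post) x → F x = h (.zero (gTilde S h R x)))
    (hfresh : ∀ p, fresh p ≠ h p →
      ∃ x, Touched R (pre ++ q :: post) x ∧ p = .zero (gTilde S h R x))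
    (hnorm : ∀ x, q = .toF x → Touched R (pre ++ q :: post) x) :
    respond4 S R F fresh (Table.restrict h (pre.flatMap (simPoints S R h))) q =
      (ideal S R h q, Table.restrict h ((pre ++ [q]).flatMap (simPoints S R h))) := by
  set l := pre.flatMap (simPoints S R h) with hl
  have hstep : (pre ++ [q]).flatMap (simPoints S R h) = l ++ simPoints S R h q := by simp [hl]
  -- A point with a modified fresh value is `g̃_R(x)` for some queried constellation. By the absence
  -- of PRED that constellation is queried no later than `q`. If earlier, the point is already in
  -- the table; if by `q` itself, the side condition excludes it.
  have key : ∀ p ∈ simPoints S R h q,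
      (∀ x, q.InConstellation R x → p ≠ .zero (gTilde S h R x)) →
      (Table.restrict h l p).getD (fresh p) = h p := by
    intro p hp hne
    by_cases hm : p ∈ l
    · rw [Table.restrict_of_mem h hm]; rfl
    · rw [Table.restrict_of_notMem h hm]
      by_contra hc
      obtain ⟨x, hx, rfl⟩ := hfresh p hc
      have hQ' : CrisisFree S R h ((pre ++ [q]) ++ post) := by simpa using hQ
      obtain ⟨u, hu, hux⟩ := hQ'.exists_of_mem (by simpa using hx)
        (by rw [hstep]; exact List.mem_append_right _ hp)
      rcases List.mem_append.1 hu with hu | hu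
      · exact hm (List.mem_flatMap.2 ⟨u, hu, hux.zero_mem_simPoints⟩)
      · rw [List.mem_singleton] at hu
        subst hu
        exact hne x hux rfl
  rw [hstep]
  match q with
  | .toF x => simp [respond4, ideal, hF x (hnorm x rfl), simPoints]
  | .toH (.zero y) =>
    have := key (.zero y) (by simp [simPoints]) fun x hx => absurd hx not_inConstellation_zero
    simp only [respond4]
    rw [OracleAlg.lazyRun_restrict h fresh]
    · rfl
    · simpa [OracleAlg.query, OracleAlg.points] using this
  | .toH (.pos i x) =>
    -- The absence of SELFREF supplies the side condition of `key` for all points of the completion.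
    have hself := hQ.not_selfref (.toH (.pos i x)) (by simp) _ (inConstellation_pos.2 rfl)
    have hc := OracleAlg.lazyRun_restrict h fresh (complete S R (x + R i)) l (by
      intro p hp
      refine key p (by simp [simPoints, hp]) ?_
      rintro z hz rfl
      rw [inConstellation_pos] at hz
      subst hz
      exact hself hp)
    have hmem : HQuery.pos i x ∈ (complete S R (x + R i)).points h := by
      simpa [Bits.add_add_self] using pos_mem_points_complete S R h (x + R i) i
    have hT : Touched R (pre ++ .toH (.pos i x) :: post) (x + R i) :=
      ⟨_, by simp, inConstellation_pos.2 rfl⟩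
    -- Whether the point is already in the table or is programmed now, it receives the value of `h`.
    have hv : ∀ l', (Table.restrict h l' (.zero (gTilde S h R (x + R i)))).getD (F (x + R i)) =
        h (.zero (gTilde S h R (x + R i))) := by
      intro l'
      by_cases hm : HQuery.zero (gTilde S h R (x + R i)) ∈ l'
      · rw [Table.restrict_of_mem h hm]; rfl
      · rw [Table.restrict_of_notMem h hm]; exact hF _ hT
    simp only [respond4]
    generalize (complete S R (x + R i)).lazyRun fresh (Table.restrict h l) = c at hc
    rw [run_complete] at hc
    subst hc
    dsimp only
    rw [hv, Table.update_restrict]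
    rw [OracleAlg.lazyRun_restrict h fresh]
    · refine Prod.ext rfl (Table.restrict_congr h fun p => ?_)
      simp only [OracleAlg.query, OracleAlg.points, simPoints, List.mem_append, List.mem_cons,
        List.not_mem_nil]
      tauto
    · intro p hp
      obtain rfl : p = .pos i x := by simpa [OracleAlg.query, OracleAlg.points] using hp
      rw [Table.restrict_of_mem h (by simp [hmem])]
      rfl

/-- The induction moves queries from the strategy into `pre` while the full list `Q`, which
determines the programmed points, stays fixed. The final table is recorded because it is what makes
the exchange invertible. -/
theorem CrisisFree.pairs_respond4 (D : Strategy n ℓ) (pre : List (Query n ℓ))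
    {F : Bits n → Bits n} {fresh : Hash n ℓ} {Q : List (Query n ℓ)}
    (hD : Q = pre ++ D.queries (ideal S R h)) (hQ : CrisisFree S R h Q)
    (hF : ∀ x, Touched R Q x → F x = h (.zero (gTilde S h R x)))
    (hfresh : ∀ p, fresh p ≠ h p → ∃ x, Touched R Q x ∧ p = .zero (gTilde S h R x))
    (hnorm : ∀ x, .toF x ∈ Q → Touched R Q x) :
    D.pairs (respond4 S R F fresh) (Table.restrict h (pre.flatMap (simPoints S R h))) =
        D.play (ideal S R h) ∧
      D.finalState (respond4 S R F fresh)
          (Table.restrict h (pre.flatMap (simPoints S R h))) =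
        Table.restrict h (Q.flatMap (simPoints S R h)) := by
  induction D generalizing pre with
  | halt =>
    simp only [Strategy.queries, Strategy.play, List.map_nil, List.append_nil] at hD
    subst hD
    exact ⟨rfl, rfl⟩
  | ask q k ih =>
    rw [Strategy.queries_ask] at hD
    have hr : respond4 S R F fresh (Table.restrict h (pre.flatMap (simPoints S R h))) q =
        (ideal S R h q, Table.restrict h ((pre ++ [q]).flatMap (simPoints S R h))) := by
      subst hD
      exact hQ.respond4_eq hF hfresh fun x hx => hnorm x (by simp [hx])
    obtain ⟨h1, h2⟩ := ih (ideal S R h q) (pre ++ [q]) (by simpa using hD)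
    constructor
    · rw [Strategy.pairs] at h1
      simp only [Strategy.pairs, Strategy.steps, hr, List.map_cons, Strategy.play]
      exact congrArg (_ :: ·) h1
    · simp only [Strategy.finalState, hr]
      exact h2

end CrisisFree

/-! ### Programming the simulator -/

noncomputable section Programming

open scoped Classical

variable (S : Subversion n ℓ) (R : Coins n ℓ) (h : Hash n ℓ) (Q : List (Query n ℓ))
  (F : Bits n → Bits n)

/-- The function `F`, with the value at `x` replaced by `h₀(g̃_R(x))` when the constellation of `x`
is queried. -/
def programF : Bits n → Bits n :=
  fun x => if Touched R Q x then h (.zero (gTilde S h R x)) else F x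

/-- The family `h`, with the value of `h₀` at `g̃_R(x)` replaced by `F(x)` when the constellation
of `x` is queried. -/
def programH : Hash n ℓ
  | .zero y =>
      if hy : ∃ x, Touched R Q x ∧ gTilde S h R x = y then F hy.choose else h (.zero y)
  | .pos i x => h (.pos i x)

variable {S R h Q F}

theorem programF_of_touched {x : Bits n} (hx : Touched R Q x) :
    programF S R h Q F x = h (.zero (gTilde S h R x)) := if_pos hx

theorem programF_of_not_touched {x : Bits n} (hx : ¬ Touched R Q x) :
    programF S R h Q F x = F x := if_neg hx

theorem exists_of_programH_ne {p : HQuery n ℓ} (hp : programH S R h Q F p ≠ h p) :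
    ∃ x, Touched R Q x ∧ p = .zero (gTilde S h R x) := by
  match p with
  | .zero y =>
    by_contra hc
    refine hp (dif_neg fun ⟨x, hx, e⟩ => hc ⟨x, hx, by rw [e]⟩)
  | .pos i x => exact absurd rfl hp

/-- The choice made in `programH` is forced, by injectivity of `g̃_R` on queried constellations. -/
theorem CrisisFree.programH_zero (hQ : CrisisFree S R h Q) {x : Bits n} (hx : Touched R Q x) :
    programH S R h Q F (.zero (gTilde S h R x)) = F x := by
  have hy : ∃ x', Touched R Q x' ∧ gTilde S h R x' = gTilde S h R x := ⟨x, hx, rfl⟩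
  have e : programH S R h Q F (.zero (gTilde S h R x)) = F hy.choose := dif_pos hy
  rw [e, hQ.gTilde_injOn hy.choose_spec.1 hx hy.choose_spec.2]

theorem Distinguisher.NormalForm.touched {D : Distinguisher n ℓ} (hD : D.NormalForm)
    (f : (q : Query n ℓ) → q.Ans) {x : Bits n} (hx : .toF x ∈ (D R).queries f) :
    Touched R ((D R).queries f) x := by
  obtain ⟨p, hp, e⟩ := List.mem_map.1 hx
  obtain ⟨p', hp', e'⟩ := hD R _ ((D R).completed_play f) x ⟨p, hp, e⟩
  exact ⟨p'.1, List.mem_map_of_mem hp', e'⟩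

theorem CrisisFree.game4_programmed {D : Distinguisher n ℓ} (hD : D.NormalForm)
    (hQ : CrisisFree S R h ((D R).queries (ideal S R h))) (F : Bits n → Bits n) :
    let Q := (D R).queries (ideal S R h)
    let respond := respond4 S R (programF S R h Q F) (programH S R h Q F)
    (D R).pairs respond (fun _ => none) = (D R).play (ideal S R h) ∧
      (D R).finalState respond (fun _ => none) =
        Table.restrict h (Q.flatMap (simPoints S R h)) := by
  have e : (fun _ => none : Table n ℓ) =
      Table.restrict h (([] : List (Query n ℓ)).flatMap (simPoints S R h)) := by
    funext p
    simp [Table.restrict]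
  simp only [e]
  exact hQ.pairs_respond4 (D R) [] rfl (fun x => programF_of_touched)
    (fun p => exists_of_programH_ne) fun x hx => hD.touched _ hx

/-- The exchanged data determine the run of Game 4, hence its final table, which consists of values
of the original `h` at all evaluated points. Every programmed point is evaluated, so elsewhere
`programH` is still `h`. Once `h` is known, so is the set of queried constellations, and `F` is read
off `programH` on that set and off `programF` outside it. -/
theorem program_injective {D : Distinguisher n ℓ} (hD : D.NormalForm) {h₁ h₂ : Hash n ℓ}
    {F₁ F₂ : Bits n → Bits n}
    (hQ₁ : CrisisFree S R h₁ ((D R).queries (ideal S R h₁)))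
    (hQ₂ : CrisisFree S R h₂ ((D R).queries (ideal S R h₂)))
    (hF : programF S R h₁ ((D R).queries (ideal S R h₁)) F₁ =
      programF S R h₂ ((D R).queries (ideal S R h₂)) F₂)
    (hH : programH S R h₁ ((D R).queries (ideal S R h₁)) F₁ =
      programH S R h₂ ((D R).queries (ideal S R h₂)) F₂) : h₁ = h₂ ∧ F₁ = F₂ := by
  obtain ⟨-, f₁⟩ := hQ₁.game4_programmed hD F₁
  obtain ⟨-, f₂⟩ := hQ₂.game4_programmed hD F₂
  -- Both runs of Game 4 are now the same run, so the two final tables coincide.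
  rw [hF, hH, f₂] at f₁
  have unprogrammed : ∀ (h : Hash n ℓ) (Q : List (Query n ℓ)) (F : Bits n → Bits n)
      (p : HQuery n ℓ), p ∉ Q.flatMap (simPoints S R h) → programH S R h Q F p = h p := by
    intro h Q F p hp
    by_contra hc
    obtain ⟨x, ⟨q, hq, hqx⟩, rfl⟩ := exists_of_programH_ne hc
    exact hp (List.mem_flatMap.2 ⟨q, hq, hqx.zero_mem_simPoints⟩)
  -- Equal tables have equal domains: inside, the entries agree; outside, neither family was
  -- reprogrammed.
  have hh : h₁ = h₂ := by
    funext p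
    have hp := congrFun f₁ p
    by_cases m₁ : p ∈ ((D R).queries (ideal S R h₁)).flatMap (simPoints S R h₁) <;>
      by_cases m₂ : p ∈ ((D R).queries (ideal S R h₂)).flatMap (simPoints S R h₂)
    · rw [Table.restrict_of_mem _ m₁, Table.restrict_of_mem _ m₂] at hp
      exact (Option.some.inj hp).symm
    · rw [Table.restrict_of_mem _ m₁, Table.restrict_of_notMem _ m₂] at hp
      exact absurd hp (by simp)
    · rw [Table.restrict_of_notMem _ m₁, Table.restrict_of_mem _ m₂] at hp
      exact absurd hp (by simp)
    · rw [← unprogrammed h₁ _ F₁ p m₁, hH, unprogrammed h₂ _ F₂ p m₂]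
  subst hh
  refine ⟨rfl, funext fun x => ?_⟩
  by_cases hx : Touched R ((D R).queries (ideal S R h₁)) x
  · rw [← hQ₁.programH_zero (F := F₁) hx, hH, hQ₁.programH_zero hx]
  · rw [← programF_of_not_touched (S := S) (h := h₁) (F := F₁) hx, hF, programF_of_not_touched hx]

/-- Along the interaction with the ideal answers, Game 1 could deviate only at some `F(x)`. The
normal form provides a query to the constellation of `x`, possibly a later one, and a deviation
would then be SUBV. -/
theorem transcript1_of_notMem_SUBV {D : Distinguisher n ℓ} (hD : D.NormalForm)
    (hω : (R, h) ∉ SUBV S D) :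
    transcript1 S D (R, h) = (R, (D R).play (ideal S R h)) := by
  refine Prod.ext rfl ?_
  simp only [transcript1, pairs_respond1]
  refine Strategy.play_congr _ fun q hq => ?_
  match q with
  | .toH q => rfl
  | .toF x =>
    obtain ⟨q, hq, hqx⟩ := hD.touched _ hq
    rw [← queries_steps_respond2 S R h (D R) _ (consistent_init S R h), List.mem_map] at hq
    obtain ⟨t, ht, rfl⟩ := hq
    by_contra hc
    exact hω ⟨t, ht, x, hqx, hc⟩

end Programming

/-! ### Counting -/

noncomputable section Counting

open scoped Classical
open Finset

theorem toReal_toOuterMeasure_uniformOfFintype {Ω : Type} [Fintype Ω] [Nonempty Ω] (E : Set Ω)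
    [DecidablePred (· ∈ E)] :
    ((PMF.uniformOfFintype Ω).toOuterMeasure E).toReal =
      (#{ω | ω ∈ E} : ℝ) / Fintype.card Ω := by
  rw [PMF.toOuterMeasure_uniformOfFintype_apply]
  simp [Fintype.card_subtype]

theorem toReal_map_uniformOfFintype {Ω α : Type} [Fintype Ω] [Nonempty Ω] [DecidableEq α]
    (f : Ω → α) (a : α) :
    (((PMF.uniformOfFintype Ω).map f) a).toReal = (#{ω | f ω = a} : ℝ) / Fintype.card Ω := by
  rw [← PMF.toOuterMeasure_apply_singleton, PMF.toOuterMeasure_map_apply,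
    toReal_toOuterMeasure_uniformOfFintype]
  simp

theorem hasSum_toReal_pmf {α : Type} (p : PMF α) : HasSum (fun a => (p a).toReal) 1 := by
  have h := ENNReal.hasSum_toReal p.tsum_coe_ne_top
  rwa [← ENNReal.tsum_toReal_eq p.apply_ne_top, p.tsum_coe, ENNReal.toReal_one] at h

/-- The pointwise bound `|p - q| ≤ 2b - (p - q)` holds for either sign of `p - q`, and `p - q` sums
to zero. -/
theorem tvDist_le_of_hasSum {α : Type} (p q : PMF α) {b : α → ℝ} {δ : ℝ} (hb : HasSum b δ)
    (hb0 : ∀ a, 0 ≤ b a) (h : ∀ a, (p a).toReal ≤ (q a).toReal + b a) : tvDist p q ≤ δ := by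
  have hpq := (hasSum_toReal_pmf p).sub (hasSum_toReal_pmf q)
  have h2 := (hb.mul_left 2).sub hpq
  have := hasSum_le (fun a => (abs_le.2 ⟨by linarith [h a, hb0 a], by linarith [h a]⟩ :
    |(p a).toReal - (q a).toReal| ≤ 2 * b a - ((p a).toReal - (q a).toReal)))
    hpq.summable.abs.hasSum h2
  rw [tvDist]
  linarith

theorem hasSum_card_fiber {Ω α : Type} [DecidableEq α] (s : Finset Ω) (f : Ω → α) :
    HasSum (fun a => (#{ω ∈ s | f ω = a} : ℝ)) #s := by
  have : HasSum (fun a => ∑ ω ∈ s, if a = f ω then (1 : ℝ) else 0) (∑ ω ∈ s, 1) :=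
    hasSum_sum fun ω _ => hasSum_ite_eq (f ω) 1
  simpa [Finset.sum_ite, eq_comm] using this

/-- The exchange maps each crisis-free `(R, h)` with any `F` injectively to Game 4 data with the
same transcript. The factor counts the functions `F`, which Game 1 does not use. -/
theorem card_crisisFree_le (S : Subversion n ℓ) {D : Distinguisher n ℓ} (hD : D.NormalForm)
    (τ : Transcript n ℓ) :
    #{ω | ω ∉ SUBV S D ∪ PRED S D ∪ SELFREF S D ∧ transcript1 S D ω = τ} *
        Fintype.card (Bits n → Bits n) ≤
      #{ω | transcript4 S D ω = τ} := by
  rw [← Finset.card_univ, ← Finset.card_product]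
  have free : ∀ ω : Coins n ℓ × Hash n ℓ, ω ∉ SUBV S D ∪ PRED S D ∪ SELFREF S D →
      CrisisFree S ω.1 ω.2 ((D ω.1).queries (ideal S ω.1 ω.2)) := fun ω hω =>
    crisisFree_of_notMem S ω.1 ω.2 D (fun hc => hω (.inl (.inr hc))) fun hc => hω (.inr hc)
  refine Finset.card_le_card_of_injOn (fun ω => (ω.1.1,
    programF S ω.1.1 ω.1.2 ((D ω.1.1).queries (ideal S ω.1.1 ω.1.2)) ω.2,
    programH S ω.1.1 ω.1.2 ((D ω.1.1).queries (ideal S ω.1.1 ω.1.2)) ω.2)) ?_ ?_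
  · rintro ⟨⟨R, h⟩, F⟩ hω
    simp only [coe_product, coe_filter, mem_univ, true_and, coe_univ, Set.mem_prod,
      Set.mem_ofPred_eq, Set.mem_univ, and_true] at hω
    refine Finset.mem_coe.2 (Finset.mem_filter.2 ⟨mem_univ _, ?_⟩)
    rw [← hω.2, transcript1_of_notMem_SUBV hD fun hc => hω.1 (.inl (.inl hc))]
    exact Prod.ext rfl ((free _ hω.1).game4_programmed hD F).1
  · rintro ⟨⟨R, h₁⟩, F₁⟩ hω₁ ⟨⟨R', h₂⟩, F₂⟩ hω₂ e
    simp only [coe_product, coe_filter, mem_univ, true_and, coe_univ, Set.mem_prod,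
      Set.mem_ofPred_eq, Set.mem_univ, and_true] at hω₁ hω₂
    simp only [Prod.mk.injEq] at e
    obtain ⟨rfl, hF, hH⟩ := e
    obtain ⟨rfl, rfl⟩ :=
      program_injective hD (free (R, h₁) hω₁.1) (free (R, h₂) hω₂.1) hF hH
    rfl

theorem prob_union_le (E E' : Set (Coins n ℓ × Hash n ℓ)) :
    prob (E ∪ E') ≤ prob E + prob E' := by
  simp only [prob, toReal_toOuterMeasure_uniformOfFintype, ← add_div]
  gcongr
  rw [← Nat.cast_add, Nat.cast_le]
  refine le_trans (Finset.card_le_card fun ω hω => ?_) (Finset.card_union_le _ _)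
  simpa using hω

theorem tvDist_le_prob_crisis (S : Subversion n ℓ) {D : Distinguisher n ℓ} (hD : D.NormalForm) :
    tvDist (alpha1 S D) (alpha4 S D) ≤ prob (SUBV S D ∪ PRED S D ∪ SELFREF S D) := by
  set E := SUBV S D ∪ PRED S D ∪ SELFREF S D
  set N : ℝ := ((Fintype.card (Coins n ℓ × Hash n ℓ) : ℕ) : ℝ) with hN
  set M : ℝ := ((Fintype.card (Bits n → Bits n) : ℕ) : ℝ) with hM
  have hN0 : 0 < N := Nat.cast_pos.2 Fintype.card_pos
  have hM0 : 0 < M := Nat.cast_pos.2 Fintype.card_pos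
  have hcard : (Fintype.card (Coins n ℓ × (Bits n → Bits n) × Hash n ℓ) : ℝ) = N * M := by
    simp only [hN, hM, Fintype.card_prod, Nat.cast_mul]
    ring
  rw [prob, toReal_toOuterMeasure_uniformOfFintype, ← hN]
  -- The excess allowed at a transcript is the probability of reaching it in Game 1 together with a
  -- crisis; these excesses sum to the probability of a crisis.
  have hsum := (hasSum_card_fiber ({ω | ω ∈ E} : Finset _) (transcript1 S D)).div_const N
  refine (tvDist_le_of_hasSum _ _ hsum (fun τ => by positivity) fun τ => ?_).trans_eq (by congr)
  rw [alpha1, alpha4, toReal_map_uniformOfFintype, toReal_map_uniformOfFintype, hcard, ← hN]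
  have h1 : (#{ω | transcript1 S D ω = τ} : ℝ) =
      #{ω | ω ∉ E ∧ transcript1 S D ω = τ} +
        #{ω ∈ ({ω | ω ∈ E} : Finset _) | transcript1 S D ω = τ} := by
    rw [add_comm, ← Nat.cast_add, Finset.filter_filter,
      ← Finset.card_filter_add_card_filter_not (s := {ω | transcript1 S D ω = τ}) (· ∈ E),
      Finset.filter_filter, Finset.filter_filter]
    simp only [and_comm]
  have h2 : (#{ω | ω ∉ E ∧ transcript1 S D ω = τ} : ℝ) * M ≤
      #{ω | transcript4 S D ω = τ} := by
    rw [hM, ← Nat.cast_mul, Nat.cast_le]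
    exact card_crisisFree_le S hD τ
  rw [h1, add_div]
  refine add_le_add ?_ le_rfl
  rw [div_le_div_iff₀ hN0 (by positivity)]
  linarith [mul_le_mul_of_nonneg_right h2 hN0.le]

end Counting

end Crooked

theorem mainTheorem2 (n ℓ : ℕ) (S : Crooked.Subversion n ℓ) (D : Crooked.Distinguisher n ℓ)
    (hD : D.NormalForm) :
    Crooked.tvDist (Crooked.alpha1 S D) (Crooked.alpha4 S D) ≤
      Crooked.prob (Crooked.SUBV S D) + Crooked.prob (Crooked.PRED S D) +
        Crooked.prob (Crooked.SELFREF S D) :=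
  (Crooked.tvDist_le_prob_crisis S hD).trans <|
    (Crooked.prob_union_le _ _).trans <| by gcongr; exact Crooked.prob_union_le _ _
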